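/- Let $d\ge 1$ and $n\ge 0$ be integers. For $\pi\in S_n$ let $W_\pi$ be the operator on $(\mathbb C^d)^{\otimes n}$ with $W_\pi|x_1\rangle\cdots|x_n\rangle=|x_{\pi^{-1}(1)}\rangle\cdots|x_{\pi^{-1}(n)}\rangle$, and let $\Pi_{\mathrm{sym}}^{(n)}=\frac1{n!}\sum_{\pi\in S_n}W_\pi$ be the projector onto the symmetric subspace, whose dimension is $\binom{n+d-1}{d-1}$. Let $\mathcal M_n$ be the POVM on $n$ qudits with elements $F_\psi=\binom{n+d-1}{d-1}\,(|\psi\rangle\langle\psi|)^{\otimes n}\,\mathrm d\psi$ for pure states $\psi$ of $\mathbb C^d$ ($\mathrm d\psi$ the unitarily invariant probability measure), together with the failure element $F_\bot=\mathbb I-\Pi_{\mathrm{sym}}^{(n)}$. Let $A$ be an exchangeable $n$-qudit state, that is, a positive semidefinite operator of trace $1$ on $(\mathbb C^d)^{\otimes n}$ with $A=W_\pi A W_\pi^{-1}$ for all $\pi\in S_n$ (for example $A=\rho^{\otimes n}$ for a one-qudit state $\rho$). Let $\Psi$ be the random operator obtained by measuring $A$ with $\mathcal M_n$, with $\Psi=|\psi\rangle\langle\psi|$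 for the outcome $\psi$ and $\Psi=0$ for the outcome $\bot$; "success" is the event that the outcome is not $\bot$. Assume that success has nonzero probability. For $0\le k\le n$ put $$M_k=\frac{\mathrm{Tr}_{1,\ldots,n-k}\bigl(\Pi_{\mathrm{sym}}^{(n)}A\bigr)}{\mathrm{Tr}\bigl(\Pi_{\mathrm{sym}}^{(n)}A\bigr)},$$ where $\mathrm{Tr}_{1,\ldots,n-k}$ is the partial trace over the first $n-k$ qudits. Then $M_1$ (if $n\ge1$) and $M_2$ (if $n\ge 2$) are states, and $$\mathbb E[\Psi\mid\text{success}]=\frac{\mathbb I+nM_1}{d+n},$$ $$\mathbb E[\Psi^{\otimes2}\mid\text{success}]=\frac{2\,\Pi_{\mathrm{sym}}^{(2)}}{(d+n)(d+n+1)}\Bigl((\mathbb I+nM_1)^{\otimes2}+\tbinom n2M_2-n^2M_1^{\otimes2}\Bigr),$$ and the variance $\mathrm{Var}[\Psi\mid\text{success}]:=\mathbb E[\Psi^{\otimes2}\mid\text{success}]-\mathbb E[\Psi\mid\text{success}]^{\otimes2}$ is $$\frac{W_{(1\,2)}\bigl(\mathbb I+nM_1\otimes\mathbb I+n\,\mathbb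 I\otimes M_1\bigr)}{(d+n)(d+n+1)}+\frac{n(n-1)M_2-n^2M_1^{\otimes2}}{(d+n)(d+n+1)}-\frac{(\mathbb I+nM_1)^{\otimes2}}{(d+n)^2(d+n+1)}.$$ Here terms containing $M_k$ with $k>n$ have coefficient $0$ and are read as $0$. -/

import Mathlib

open MeasureTheory ProbabilityTheory
open scoped Matrix ComplexOrder

noncomputable section

namespace SymmetricMeasurement

/-- Linear operators on one qudit, the Hilbert space being `ℂ^d`. -/
abbrev QuditOp (d : ℕ) : Type := Matrix (Fin d) (Fin d) ℂ

/-- Linear operators on `n` qudits, that is on `(ℂ^d)^{⊗ n}`, as matrices in the computational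
basis `|x₁⟩ ⋯ |xₙ⟩`, whose elements are indexed by the functions `x : Fin n → Fin d`. -/
abbrev Op (d n : ℕ) : Type := Matrix (Fin n → Fin d) (Fin n → Fin d) ℂ

/-- The tensor product `B₁ ⊗ ⋯ ⊗ Bₙ` of one-qudit operators. -/
def tensor {d n : ℕ} (B : Fin n → QuditOp d) : Op d n :=
  Matrix.of fun x y => ∏ i, B i (x i) (y i)

/-- The tensor power `B^{⊗ n}`. -/
def tensorPow {d : ℕ} (n : ℕ) (B : QuditOp d) : Op d n :=
  tensor fun _ => B

/-- A state (density matrix): positive semidefinite of trace one. -/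
def IsState {ι : Type} [Fintype ι] (A : Matrix ι ι ℂ) : Prop :=
  A.PosSemidef ∧ A.trace = 1

/-- The permutation operator `W_π`, with `W_π |x₁ ⋯ xₙ⟩ = |x_{π⁻¹(1)} ⋯ x_{π⁻¹(n)}⟩`. -/
def permOp (d : ℕ) {n : ℕ} (π : Equiv.Perm (Fin n)) : Op d n :=
  Matrix.of fun y x => if y = x ∘ ⇑π⁻¹ then 1 else 0

/-- Exchangeable operators: `A = W_π A W_π⁻¹` for every permutation `π`. -/
def IsExchangeable {d n : ℕ} (A : Op d n) : Prop :=
  ∀ π : Equiv.Perm (Fin n), A = permOp d π * A * (permOp d π)⁻¹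

/-- The projector onto the symmetric subspace of `n` qudits, `(1 / n!) ∑_π W_π`. -/
def symProj (d n : ℕ) : Op d n :=
  ((n.factorial : ℂ))⁻¹ • ∑ π : Equiv.Perm (Fin n), permOp d π

/-- The dimension `binom (n + d - 1) (d - 1)` of the symmetric subspace (for `d ≥ 1`). -/
def symDim (d n : ℕ) : ℕ := (n + d - 1).choose (d - 1)

/-- Partial trace over the first `m` of `m + k` qudits. -/
def traceFirst {d : ℕ} (m k : ℕ) (B : Op d (m + k)) : Op d k :=
  Matrix.of fun x y => ∑ z : Fin m → Fin d, B (Fin.append z x) (Fin.append z y)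

/-- The symmetric partial trace `Tr_{n → k}(A) = Tr_{1, …, n-k}(Π_sym A)`, for `k ≤ n`
(and `0` for `k > n`, where there is no such operator). -/
def symTrace {d n : ℕ} (k : ℕ) (A : Op d n) : Op d k :=
  if h : k ≤ n then
    traceFirst (n - k) k
      ((symProj d n * A).submatrix
        (fun x => x ∘ Fin.cast (Nat.sub_add_cancel h).symm)
        (fun x => x ∘ Fin.cast (Nat.sub_add_cancel h).symm))
  else 0

/-- The normalized symmetric partial trace `M_k(A) = Tr_{n → k}(A) / Tr(Π_sym A)`. -/
def M {d n : ℕ} (k : ℕ) (A : Op d n) : Op d k :=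
  ((symProj d n * A).trace)⁻¹ • symTrace k A

/-- `M_1(A)`, read as an operator on `ℂ^d`. -/
def M₁ {d n : ℕ} (A : Op d n) : QuditOp d :=
  Matrix.of fun a b => M 1 A (fun _ => a) (fun _ => b)

/-- `M_2(A)`. -/
def M₂ {d n : ℕ} (A : Op d n) : Op d 2 := M 2 A

/-- Unit vectors `ψ` of `ℂ^d`. -/
abbrev UnitVec (d : ℕ) : Type := Metric.sphere (0 : EuclideanSpace ℂ (Fin d)) 1

/-- The rank-one projector `|ψ⟩⟨ψ|`. -/
def proj {d : ℕ} (ψ : UnitVec d) : QuditOp d :=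
  Matrix.of fun a b => ψ.1 a * star (ψ.1 b)

/-- The uniform (unitarily invariant) probability measure `dψ` on unit vectors: the surface
measure of the unit sphere of `ℂ^d = ℝ^{2d}`, normalized. -/
def haar (d : ℕ) : Measure (UnitVec d) :=
  ((volume : Measure (EuclideanSpace ℂ (Fin d))).toSphere Set.univ)⁻¹ •
    (volume : Measure (EuclideanSpace ℂ (Fin d))).toSphere

/-- Outcomes of the measurement: `Sum.inl ψ` is the outcome `ψ` and `Sum.inr ()` is the
failure outcome `⊥`. -/
abbrev Outcome (d : ℕ) : Type := UnitVec d ⊕ Unit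

/-- The density with respect to `dψ` of the POVM element `F_ψ`. -/
def effect {d : ℕ} (n : ℕ) (ψ : UnitVec d) : Op d n :=
  (symDim d n : ℂ) • tensorPow n (proj ψ)

/-- The POVM element `F_⊥ = 1 - Π_sym` of the failure outcome. -/
def effectFail (d n : ℕ) : Op d n := 1 - symProj d n

/-- The law of the outcome of the standard symmetric joint measurement of the `n`-qudit state
`A` (Born rule): density `Tr(F_ψ A)` with respect to `dψ` on the outcomes `ψ`, and mass
`Tr(F_⊥ A)` on the failure outcome. -/
def outcomeLaw {d n : ℕ} (A : Op d n) : Measure (Outcome d) :=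
  ((haar d).withDensity fun ψ => ENNReal.ofReal ((effect n ψ * A).trace.re)).map Sum.inl +
    ENNReal.ofReal ((effectFail d n * A).trace.re) • Measure.dirac (Sum.inr ())

/-- The operator `Ψ` attached to an outcome: `|ψ⟩⟨ψ|` for the outcome `ψ`, and `0` for `⊥`. -/
def Psi {d : ℕ} : Outcome d → QuditOp d
  | Sum.inl ψ => proj ψ
  | Sum.inr _ => 0

/-- The set of successful outcomes (all but `⊥`). -/
def success (d : ℕ) : Set (Outcome d) := Set.range Sum.inl

/-- For a random outcome `X` on `(Ω, P)`: the probability measure `P` conditioned on success. -/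
def condSuccess {Ω : Type*} [MeasurableSpace Ω] {d : ℕ} (P : Measure Ω) (X : Ω → Outcome d) :
    Measure Ω :=
  ProbabilityTheory.cond P (X ⁻¹' success d)

/-- A random matrix is integrable when all its entries are. -/
def MatIntegrable {Ω ι : Type*} [MeasurableSpace Ω] (F : Ω → Matrix ι ι ℂ) (μ : Measure Ω) :
    Prop :=
  ∀ i j, Integrable (fun ω => F ω i j) μ

/-- The expectation of a random matrix, entry by entry. -/
def expect {Ω ι : Type*} [MeasurableSpace Ω] (μ : Measure Ω) (F : Ω → Matrix ι ι ℂ) :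
    Matrix ι ι ℂ :=
  Matrix.of fun i j => ∫ ω, F ω i j ∂μ

/-- The variance `E[F ⊗ F] - E[F] ⊗ E[F]` of a random one-qudit operator, an operator on two
qudits. -/
def matVariance {Ω : Type*} [MeasurableSpace Ω] {d : ℕ} (μ : Measure Ω) (F : Ω → QuditOp d) :
    Op d 2 :=
  expect μ (fun ω => tensorPow 2 (F ω)) - tensorPow 2 (expect μ F)

end SymmetricMeasurement

end

open SymmetricMeasurement

/-!
The conditional moments of `Ψ` are matrix entries of the moments of the uniform measure on unit
vectors, because by the Born rule
`E[Ψ^{⊗ k}; success] = symDim d n • ∫ |ψ⟩⟨ψ|^{⊗ k} Tr(|ψ⟩⟨ψ|^{⊗ n} A) dψ`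
(`setIntegral_success`).

The moments of the uniform measure are (`integral_proj_tensorPow`)
`∫ ∏ᵢ ψ(uᵢ) conj ψ(vᵢ) dψ = (d - 1)! / (m + d - 1)! * matchCount u v`,
where `matchCount u v` is the number of permutations `σ` of the `m` positions with `u = v ∘ σ`.
This is obtained by integrating the same monomial against the Gaussian `exp (-‖z‖²)` on `ℂ^d` in two
ways: in polar coordinates it is the integral over the sphere times a Gamma factor, and in
coordinates it is a product of moments of one-dimensional complex Gaussians. Up to the factor `n!`,
`matchCount` is also the matrix of the projector onto the symmetric subspace (`symProj_apply`).

It remains to evaluate `∑ A v u * matchCount (x, u) (y, v)` where `x`, `y` add one or two indices.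
Expanding the permanent `matchCount` along the rows of the added indices (`matchCount_cons`) gives
terms in which an added index is matched either with an added one, or with one of the `n` qudits of
`A`. In the second case it is substituted there, and since `A` is exchangeable the result does not
depend on which qudits were chosen: it is an entry of the symmetric partial trace
(`IsExchangeable.sum_extend_eq_symTrace`). There are `n` choices for one marked qudit and
`n (n - 1)` for an ordered pair of them, which are the coefficients of `M₁` and `M₂`.
-/

namespace SymmetricMeasurement

/-! ### Gaussian integrals in polar coordinates -/

/-- Moments of the complex Gaussian. The mixed ones vanish because rotations preserve the weight. -/
theorem integral_mul_gaussian_complex (a b : ℕ) :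
    ∫ z : ℂ, z ^ a * star z ^ b * (Real.exp (-‖z‖ ^ 2) : ℂ) =
      if a = b then (Real.pi * a.factorial : ℂ) else 0 := by
  split_ifs with h
  · subst h
    have h1 := Complex.integral_rpow_mul_exp_neg_rpow (p := 2) (q := 2 * a) (by norm_num)
      (by have : (0:ℝ) ≤ a := a.cast_nonneg
          linarith)
    have h2 : ∀ z : ℂ, z ^ a * star z ^ a * (Real.exp (-‖z‖ ^ 2) : ℂ) =
        ((‖z‖ ^ (2 * a : ℝ) * Real.exp (-‖z‖ ^ (2 : ℝ)) : ℝ) : ℂ) := by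
      intro z
      rw [← mul_pow, Complex.star_def, Complex.mul_conj, Complex.normSq_eq_norm_sq,
        Real.rpow_two, Real.rpow_mul (norm_nonneg _), Real.rpow_natCast, Real.rpow_two]
      push_cast
      rfl
    simp_rw [h2]
    rw [integral_complex_ofReal, h1]
    have h3 : ((2 * a + 2 : ℝ) / 2) = a + 1 := by ring
    rw [h3, Real.Gamma_nat_eq_factorial]
    push_cast
    ring
  · have hab : (a : ℂ) - b ≠ 0 := sub_ne_zero.2 (by exact_mod_cast h)
    -- a rotation multiplying the integrand by `-1`
    set w : Circle := Circle.exp (Real.pi / ((a : ℝ) - b)) with hw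
    have hwv : (w : ℂ) ^ a * star (w : ℂ) ^ b = -1 := by
      rw [hw, Complex.star_def, ← Circle.coe_inv_eq_conj, ← Circle.exp_neg, Circle.coe_exp,
        Circle.coe_exp, ← Complex.exp_nat_mul, ← Complex.exp_nat_mul, ← Complex.exp_add,
        ← Complex.exp_pi_mul_I]
      congr 1
      push_cast
      field_simp
      ring
    have key := (rotation w).measurePreserving.integral_comp
      (rotation w).toMeasurableEquiv.measurableEmbedding
      (fun z : ℂ => z ^ a * star z ^ b * (Real.exp (-‖z‖ ^ 2) : ℂ))
    simp only [rotation_apply, norm_mul, Circle.norm_coe, one_mul, star_mul', mul_pow] at key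
    have h4 : ∀ z : ℂ, (w : ℂ) ^ a * z ^ a * (star (w : ℂ) ^ b * star z ^ b) *
        (Real.exp (-‖z‖ ^ 2) : ℂ) = -(z ^ a * star z ^ b * (Real.exp (-‖z‖ ^ 2) : ℂ)) := by
      intro z
      linear_combination (z ^ a * star z ^ b * (Real.exp (-‖z‖ ^ 2) : ℂ)) * hwv
    simp only [h4, integral_neg] at key
    exact self_eq_neg.1 key.symm

/-- Polar coordinates for a function that is homogeneous of degree `m`, against the Gaussian weight. -/
theorem integral_mul_gaussian_eq_integral_toSphere {E : Type*} [NormedAddCommGroup E]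
    [NormedSpace ℝ E] [MeasurableSpace E] [BorelSpace E] [FiniteDimensional ℝ E] [Nontrivial E]
    (μ : Measure E) [μ.IsAddHaarMeasure] (f : E → ℂ) (m : ℕ)
    (hf : ∀ (r : ℝ) (u : E), 0 < r → f (r • u) = (r : ℂ) ^ m * f u) :
    ∫ z, f z * (Real.exp (-‖z‖ ^ 2) : ℂ) ∂μ =
      (∫ u : Metric.sphere (0 : E) 1, f u ∂μ.toSphere) *
        (Real.Gamma (((m + Module.finrank ℝ E : ℕ) : ℝ) / 2) / 2 : ℝ) := by
  have hD : 0 < Module.finrank ℝ E := Module.finrank_pos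
  set D := Module.finrank ℝ E with hDdef
  have hmp := μ.measurePreserving_homeomorphUnitSphereProd
  calc ∫ z, f z * (Real.exp (-‖z‖ ^ 2) : ℂ) ∂μ
      = ∫ z : ({0}ᶜ : Set E), f z * (Real.exp (-‖(z : E)‖ ^ 2) : ℂ) ∂(μ.comap (↑)) := by
        rw [integral_subtype_comap (measurableSet_singleton _).compl
          fun z ↦ f z * (Real.exp (-‖z‖ ^ 2) : ℂ), restrict_compl_singleton]
    _ = ∫ p : Metric.sphere (0 : E) 1 × Set.Ioi (0 : ℝ),
          f p.1 * (((p.2 : ℝ) ^ m * Real.exp (-(p.2 : ℝ) ^ 2) : ℝ) : ℂ)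
          ∂(μ.toSphere.prod (Measure.volumeIoiPow (D - 1))) := by
        rw [← hmp.integral_comp (Homeomorph.measurableEmbedding _)]
        refine integral_congr_ae (Filter.Eventually.of_forall fun z => ?_)
        have hz : 0 < ‖(z : E)‖ := norm_pos_iff.2 z.2
        have h1 : (z : E) = ‖(z : E)‖ • (‖(z : E)‖⁻¹ • (z : E)) := by
          rw [smul_smul, mul_inv_cancel₀ hz.ne', one_smul]
        have h2 := hf ‖(z : E)‖ (‖(z : E)‖⁻¹ • (z : E)) hz
        rw [← h1] at h2
        simp only [homeomorphUnitSphereProd_apply_fst_coe, homeomorphUnitSphereProd_apply_snd_coe]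
        rw [h2]
        push_cast
        ring
    _ = (∫ u : Metric.sphere (0 : E) 1, f u ∂μ.toSphere) *
        ∫ r : Set.Ioi (0 : ℝ), (((r : ℝ) ^ m * Real.exp (-(r : ℝ) ^ 2) : ℝ) : ℂ)
          ∂(Measure.volumeIoiPow (D - 1)) :=
        integral_prod_mul (fun u : Metric.sphere (0 : E) 1 => f u)
          (fun r : Set.Ioi (0 : ℝ) => (((r : ℝ) ^ m * Real.exp (-(r : ℝ) ^ 2) : ℝ) : ℂ))
    _ = _ := by
        congr 1
        rw [integral_complex_ofReal]
        congr 1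
        rw [Measure.volumeIoiPow, integral_withDensity_eq_integral_toReal_smul
          (by fun_prop) (Filter.Eventually.of_forall fun _ => ENNReal.ofReal_lt_top)]
        have h3 := _root_.integral_rpow_mul_exp_neg_rpow (p := 2) (q := ((m + D - 1 : ℕ) : ℝ))
          (by norm_num) (by have : (0:ℝ) ≤ ((m + D - 1 : ℕ) : ℝ) := Nat.cast_nonneg _
                            linarith)
        have h4 : (((m + D - 1 : ℕ) : ℝ) + 1) = ((m + D : ℕ) : ℝ) := by
          have : m + D - 1 + 1 = m + D := by omega
          exact_mod_cast this
        rw [h4] at h3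
        rw [div_eq_inv_mul, ← one_div, ← h3,
          integral_subtype_comap measurableSet_Ioi
            fun r : ℝ ↦ (ENNReal.ofReal (r ^ (D - 1))).toReal • (r ^ m * Real.exp (-r ^ 2))]
        refine setIntegral_congr_fun measurableSet_Ioi fun r hr => ?_
        have hr' : (0 : ℝ) < r := hr
        simp only [smul_eq_mul, Real.rpow_natCast, Real.rpow_two]
        rw [ENNReal.toReal_ofReal (by positivity), ← mul_assoc, ← pow_add]
        congr 2
        omega

/-! ### Moments of the uniform measure on the unit sphere -/

/-- The number of positions at which the word `u` has the letter `c`. -/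
def fiberCard {n d : ℕ} (u : Fin n → Fin d) (c : Fin d) : ℕ :=
  Fintype.card {i // u i = c}

/-- The number of permutations `σ` with `u = v ∘ σ`, as a complex number. It is the permanent of the
matrix with entries `1` where `u i = v j` and `0` elsewhere. -/
noncomputable def matchCount {n d : ℕ} (u v : Fin n → Fin d) : ℂ :=
  ∑ σ : Equiv.Perm (Fin n), if u = v ∘ σ then 1 else 0

theorem exists_perm_of_fiberCard_eq {n d : ℕ} {u v : Fin n → Fin d}
    (h : fiberCard u = fiberCard v) : ∃ σ : Equiv.Perm (Fin n), u = v ∘ σ := by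
  have e : ∀ c, {i // u i = c} ≃ {i // v i = c} := fun c =>
    Fintype.equivOfCardEq (congrFun h c)
  refine ⟨(Equiv.sigmaFiberEquiv u).symm.trans
    ((Equiv.sigmaCongrRight fun c => e c).trans (Equiv.sigmaFiberEquiv v)), ?_⟩
  funext i
  exact ((e (u i) ⟨i, rfl⟩).2).symm

/-- The permutations with `u = v ∘ σ` exist only if `u` and `v` use every letter equally often, and are
then a coset of the stabilizer of `v`. -/
theorem matchCount_eq {n d : ℕ} (u v : Fin n → Fin d) :
    matchCount u v = ∏ c, if fiberCard u c = fiberCard v c then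
      ((fiberCard u c).factorial : ℂ) else 0 := by
  by_cases h : fiberCard u = fiberCard v
  · obtain ⟨τ, rfl⟩ := exists_perm_of_fiberCard_eq h
    have h1 : matchCount (v ∘ τ) v = (Fintype.card {σ : Equiv.Perm (Fin n) // v ∘ σ = v} : ℂ) := by
      rw [matchCount, Fintype.card_subtype, Finset.sum_boole]
      congr 1
      refine Finset.card_bij (fun σ _ => σ * τ⁻¹) ?_ (fun _ _ _ _ => mul_right_cancel) ?_
      · intro σ hσ
        simp only [Finset.mem_filter, Finset.mem_univ, true_and] at hσ ⊢
        rw [Equiv.Perm.coe_mul, ← Function.comp_assoc, ← hσ, Function.comp_assoc,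
          ← Equiv.Perm.coe_mul, mul_inv_cancel, Equiv.Perm.coe_one, Function.comp_id]
      · intro σ hσ
        simp only [Finset.mem_filter, Finset.mem_univ, true_and] at hσ
        refine ⟨σ * τ, ?_, by simp⟩
        simp only [Finset.mem_filter, Finset.mem_univ, true_and]
        rw [Equiv.Perm.coe_mul, ← Function.comp_assoc, hσ]
    rw [h1, DomMulAct.stabilizer_card]
    simp only [h, if_true]
    push_cast
    rfl
  · obtain ⟨c, hc⟩ := Function.ne_iff.1 h
    rw [Finset.prod_eq_zero (Finset.mem_univ c) (if_neg hc)]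
    refine Finset.sum_eq_zero fun σ _ => if_neg ?_
    rintro rfl
    exact hc (Fintype.card_congr (σ.subtypeEquiv fun _ => Iff.rfl))

theorem prod_comp_eq_prod_pow_fiberCard {n d : ℕ} (u : Fin n → Fin d) (g : Fin d → ℂ) :
    ∏ i, g (u i) = ∏ c, g c ^ fiberCard u c := by
  rw [← Finset.prod_fiberwise (s := Finset.univ) (g := u)]
  refine Finset.prod_congr rfl fun c _ => ?_
  rw [fiberCard, Fintype.card_subtype]
  exact Finset.prod_eq_pow_card fun i hi => by rw [(Finset.mem_filter.1 hi).2]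

theorem integral_pi_gaussian {n d : ℕ} (u v : Fin n → Fin d) :
    ∫ z : Fin d → ℂ, (∏ i, z (u i) * star (z (v i))) *
        (∏ c, (Real.exp (-‖z c‖ ^ 2) : ℂ)) =
      Real.pi ^ d * matchCount u v := by
  have h : ∀ z : Fin d → ℂ, (∏ i, z (u i) * star (z (v i))) *
        (∏ c, (Real.exp (-‖z c‖ ^ 2) : ℂ)) =
      ∏ c, (z c ^ fiberCard u c * star (z c) ^ fiberCard v c *
        (Real.exp (-‖z c‖ ^ 2) : ℂ)) := by
    intro z
    rw [Finset.prod_mul_distrib, prod_comp_eq_prod_pow_fiberCard u z,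
      prod_comp_eq_prod_pow_fiberCard v (fun c => star (z c)), Finset.prod_mul_distrib,
      Finset.prod_mul_distrib]
  simp_rw [h]
  rw [integral_fintype_prod_volume_eq_prod
    (fun c (z : ℂ) => z ^ fiberCard u c * star z ^ fiberCard v c *
        (Real.exp (-‖z‖ ^ 2) : ℂ))]
  simp_rw [integral_mul_gaussian_complex]
  rw [matchCount_eq]
  have : (Real.pi : ℂ) ^ d = ∏ _c : Fin d, (Real.pi : ℂ) := by simp
  rw [this, ← Finset.prod_mul_distrib]
  refine Finset.prod_congr rfl fun c _ => ?_
  split_ifs <;> simp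

/-- Gaussian moments on `ℂ^d`. The constant `k` is `π ^ d` times the ratio of the volume of the
Euclidean space to the product measure; it cancels on the sphere, where total mass is `1`, so its
value is left open. -/
theorem exists_integral_gaussian (d : ℕ) : ∃ k : ℂ, k ≠ 0 ∧ ∀ (n : ℕ) (u v : Fin n → Fin d),
    ∫ z : EuclideanSpace ℂ (Fin d), (∏ i, z (u i) * star (z (v i))) *
        (Real.exp (-‖z‖ ^ 2) : ℂ) = k * matchCount u v := by
  let e : (Fin d → ℂ) ≃L[ℝ] EuclideanSpace ℂ (Fin d) :=
    (PiLp.continuousLinearEquiv 2 ℝ fun _ : Fin d => ℂ).symm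
  -- Both measures are additive Haar measures, hence proportional, whatever their normalizations.
  let ν : Measure (EuclideanSpace ℂ (Fin d)) := (volume : Measure (Fin d → ℂ)).map e
  have hν : ν.IsAddHaarMeasure := e.isAddHaarMeasure_map _
  obtain ⟨k, hk0, hk⟩ : ∃ k : NNReal, k ≠ 0 ∧
      (volume : Measure (EuclideanSpace ℂ (Fin d))) = k • ν :=
    ⟨_, (Measure.addHaarScalarFactor_pos_of_isAddHaarMeasure _ _).ne',
      Measure.isAddLeftInvariant_eq_smul _ _⟩
  refine ⟨k * (Real.pi : ℂ) ^ d, by simp [hk0, Real.pi_ne_zero], fun n u v => ?_⟩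
  rw [hk, integral_smul_nnreal_measure, NNReal.smul_def, Complex.real_smul]
  change _ * ∫ z, _ ∂((volume : Measure (Fin d → ℂ)).map e.toHomeomorph) = _
  rw [e.toHomeomorph.measurableEmbedding.integral_map, mul_assoc, ← integral_pi_gaussian]
  simp only [EuclideanSpace.norm_sq_eq, ← Finset.sum_neg_distrib, Real.exp_sum]
  push_cast
  rfl

/-- The matrix entries of `∫ (|ψ⟩⟨ψ|)^{⊗ n} dψ`. -/
theorem integral_proj_tensorPow {d : ℕ} (hd : 1 ≤ d) {n : ℕ} (u v : Fin n → Fin d) :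
    ∫ ψ, tensorPow n (proj ψ) u v ∂haar d =
      ((d - 1).factorial / (n + d - 1).factorial : ℂ) * matchCount u v := by
  have : Nonempty (Fin d) := ⟨⟨0, hd⟩⟩
  obtain ⟨k, hk0, hk⟩ := exists_integral_gaussian d
  have hfr : Module.finrank ℝ (EuclideanSpace ℂ (Fin d)) = 2 * d := by
    rw [← Module.finrank_mul_finrank ℝ ℂ, finrank_euclideanSpace_fin, Complex.finrank_real_complex]
  have key : ∀ (n : ℕ) (u v : Fin n → Fin d), k * matchCount u v =
      (∫ ψ : UnitVec d, tensorPow n (proj ψ) u v ∂(volume.toSphere)) *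
        (((n + d - 1).factorial : ℂ) / 2) := by
    intro n u v
    rw [← hk, integral_mul_gaussian_eq_integral_toSphere _ _ (2 * n), hfr]
    · have h : (((2 * n + 2 * d : ℕ) : ℝ) / 2) = ((n + d - 1 : ℕ) : ℝ) + 1 := by
        have : n + d - 1 + 1 = n + d := by omega
        rw [← Nat.cast_add_one, this]
        push_cast
        ring
      rw [h, Real.Gamma_nat_eq_factorial]
      push_cast
      rfl
    · intro r u _
      simp only [PiLp.smul_apply, Complex.real_smul, star_mul', Complex.star_def,
        Complex.conj_ofReal]
      have : (r : ℂ) ^ (2 * n) = ∏ _i : Fin n, (r : ℂ) ^ 2 := by simp [pow_mul]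
      rw [this, ← Finset.prod_mul_distrib]
      exact Finset.prod_congr rfl fun i _ => by ring
  -- The empty monomial gives the total mass of the sphere, by which `haar` is normalized.
  have hS := key 0 Fin.elim0 Fin.elim0
  have hone : matchCount (Fin.elim0 : Fin 0 → Fin d) Fin.elim0 = 1 := by
    simp [matchCount, Subsingleton.elim _ (Fin.elim0 : Fin 0 → Fin d)]
  have hone' : ∀ ψ : UnitVec d, tensorPow 0 (proj ψ) Fin.elim0 Fin.elim0 = 1 := fun ψ => by
    simp [tensorPow, tensor]
  simp only [hone, hone', integral_const, zero_add, mul_one, Complex.real_smul] at hS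
  have hn := key n u v
  have hf1 : ((d - 1).factorial : ℂ) ≠ 0 := by exact_mod_cast Nat.factorial_ne_zero _
  have hf2 : ((n + d - 1).factorial : ℂ) ≠ 0 := by exact_mod_cast Nat.factorial_ne_zero _
  rw [haar, integral_smul_measure, ENNReal.toReal_inv, Complex.real_smul]
  change _ = ((volume.toSphere : Measure (UnitVec d)).real Set.univ : ℂ) * _ at hS
  change ((((volume.toSphere : Measure (UnitVec d)).real Set.univ)⁻¹ : ℝ) : ℂ) * _ = _
  have hs0 : ((volume.toSphere : Measure (UnitVec d)).real Set.univ : ℂ) ≠ 0 := by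
    intro h
    rw [h, zero_mul] at hS
    exact hk0 hS
  push_cast
  rw [hS] at hn
  field_simp at hn ⊢
  linear_combination -hn

/-! ### Permutation operators, the symmetric projector and partial traces -/

variable {d n : ℕ}

theorem ite_and_eq_mul (p q : Prop) [Decidable p] [Decidable q] :
    (if p ∧ q then (1 : ℂ) else 0) = (if p then 1 else 0) * (if q then 1 else 0) := by
  by_cases p <;> by_cases q <;> simp [*]

/-- Expansion of a permanent along its first row, with the first column moved to the place of the
column `j` that is removed. -/
theorem matchCount_cons (a b : Fin d) (u v : Fin n → Fin d) :
    matchCount (Fin.cons a u : Fin (n + 1) → Fin d) (Fin.cons b v : Fin (n + 1) → Fin d) =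
      (if a = b then 1 else 0) * matchCount u v +
        ∑ j, (if a = v j then 1 else 0) * matchCount u (Function.update v j b) := by
  unfold matchCount
  rw [← Equiv.sum_comp Equiv.Perm.decomposeFin.symm, Fintype.sum_prod_type, Fin.sum_univ_succ]
  have h : ∀ (w : Fin (n + 1) → Fin d),
      ((Fin.cons a u : Fin (n + 1) → Fin d) = w) ↔ a = w 0 ∧ u = fun i => w i.succ := by
    intro w
    constructor
    · rintro rfl
      exact ⟨rfl, rfl⟩
    · rintro ⟨rfl, rfl⟩
      exact Fin.cons_self_tail w
  simp only [h, Function.comp_apply, Equiv.Perm.decomposeFin_symm_apply_zero,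
    Equiv.Perm.decomposeFin_symm_apply_succ, Fin.cons_zero, Fin.cons_succ, Finset.mul_sum,
    ite_and_eq_mul]
  congr 1
  · refine Finset.sum_congr rfl fun j _ => Finset.sum_congr rfl fun σ _ => ?_
    congr 2
    refine congrArg (u = ·) (funext fun i => ?_)
    rw [Function.comp_apply]
    by_cases hj : σ i = j
    · subst hj
      simp
    · rw [Equiv.swap_apply_of_ne_of_ne (Fin.succ_ne_zero _) (fun h => hj (Fin.succ_injective _ h)),
        Function.update_of_ne hj, Fin.cons_succ]

theorem eq_comp_perm_inv_iff (π : Equiv.Perm (Fin n)) (x y : Fin n → Fin d) :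
    x = y ∘ ⇑π⁻¹ ↔ x ∘ π = y :=
  Equiv.eq_comp_symm π x y

theorem permOp_mul_apply (π : Equiv.Perm (Fin n)) (B : Op d n) (x y : Fin n → Fin d) :
    (permOp d π * B) x y = B (x ∘ π) y := by
  simp only [Matrix.mul_apply, permOp, Matrix.of_apply, eq_comp_perm_inv_iff, ite_mul, one_mul,
    zero_mul, Finset.sum_ite_eq, Finset.mem_univ, if_true]

theorem permOp_mul_permOp (π σ : Equiv.Perm (Fin n)) :
    permOp d π * permOp d σ = permOp d (π * σ) := by
  ext x y
  rw [permOp_mul_apply]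
  simp only [permOp, Matrix.of_apply, eq_comp_perm_inv_iff]
  rfl

theorem permOp_one : permOp d (1 : Equiv.Perm (Fin n)) = 1 := by
  ext x y
  simp [permOp, Matrix.one_apply]

theorem permOp_conjTranspose (π : Equiv.Perm (Fin n)) : (permOp d π)ᴴ = permOp d π⁻¹ := by
  ext x y
  simp only [permOp, Matrix.conjTranspose_apply, Matrix.of_apply, apply_ite star,
    star_one, star_zero, eq_comp_perm_inv_iff]
  exact if_congr (by rw [← eq_comp_perm_inv_iff, eq_comm]) rfl rfl

theorem IsExchangeable.permOp_mul {A : Op d n} (hex : IsExchangeable A)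
    (π : Equiv.Perm (Fin n)) : permOp d π * A = A * permOp d π := by
  have h1 : permOp d π⁻¹ * permOp d π = 1 := by
    rw [permOp_mul_permOp, inv_mul_cancel, permOp_one]
  have h2 := hex π
  rw [Matrix.inv_eq_left_inv h1] at h2
  conv_rhs => rw [h2, Matrix.mul_assoc, h1, Matrix.mul_one]

theorem IsExchangeable.symProj_mul {A : Op d n} (hex : IsExchangeable A) :
    symProj d n * A = A * symProj d n := by
  simp only [symProj, Matrix.smul_mul, Matrix.mul_smul, Finset.sum_mul, Finset.mul_sum,
    hex.permOp_mul]

theorem permOp_mul_symProj (π : Equiv.Perm (Fin n)) :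
    permOp d π * symProj d n = symProj d n := by
  simp only [symProj, Matrix.mul_smul, Finset.mul_sum, permOp_mul_permOp]
  congr 1
  exact Equiv.sum_comp (Equiv.mulLeft π) (fun σ => permOp d σ)

theorem symProj_mul_self : symProj d n * symProj d n = symProj d n := by
  conv_lhs => enter [1]; rw [symProj]
  rw [Matrix.smul_mul, Finset.sum_mul]
  simp only [permOp_mul_symProj, Finset.sum_const, Finset.card_univ, Fintype.card_perm,
    Fintype.card_fin]
  rw [← Nat.cast_smul_eq_nsmul ℂ, smul_smul, inv_mul_cancel₀, one_smul]
  exact_mod_cast n.factorial_ne_zero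

theorem symProj_conjTranspose : (symProj d n)ᴴ = symProj d n := by
  simp only [symProj, Matrix.conjTranspose_smul, Matrix.conjTranspose_sum, permOp_conjTranspose]
  have h : ∑ π : Equiv.Perm (Fin n), permOp d π⁻¹ = ∑ π, permOp d π :=
    Equiv.sum_comp (Equiv.inv _) (fun σ : Equiv.Perm (Fin n) => permOp d σ)
  rw [h]
  simp

theorem symProj_apply (u v : Fin n → Fin d) :
    symProj d n u v = (n.factorial : ℂ)⁻¹ * matchCount u v := by
  rw [symProj, Matrix.smul_apply, smul_eq_mul, Matrix.sum_apply, matchCount,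
    ← Equiv.sum_comp (Equiv.inv _)]
  simp only [permOp, Matrix.of_apply, Equiv.inv_apply, inv_inv]

/-- `Π A` is positive semidefinite, since it equals `Π A Π`. -/
theorem IsExchangeable.symProj_mul_posSemidef {A : Op d n} (hex : IsExchangeable A)
    (hA : A.PosSemidef) : (symProj d n * A).PosSemidef := by
  have h : symProj d n * A = (symProj d n)ᴴ * A * symProj d n := by
    rw [symProj_conjTranspose, hex.symProj_mul, Matrix.mul_assoc, symProj_mul_self]
  rw [h]
  exact hA.conjTranspose_mul_mul_same _

theorem symProj_mul_comp_left (A : Op d n) (π : Equiv.Perm (Fin n)) (x y : Fin n → Fin d) :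
    (symProj d n * A) (x ∘ π) y = (symProj d n * A) x y := by
  rw [← permOp_mul_apply π (symProj d n * A), ← Matrix.mul_assoc, permOp_mul_symProj]

theorem IsExchangeable.symProj_mul_comp_right {A : Op d n} (hex : IsExchangeable A)
    (π : Equiv.Perm (Fin n)) (x y : Fin n → Fin d) :
    (symProj d n * A) x (y ∘ π) = (symProj d n * A) x y := by
  have h : ∀ u v : Fin n → Fin d, matchCount u (v ∘ π) = matchCount u v := fun u v =>
    Equiv.sum_comp (Equiv.mulLeft π) (fun σ => if u = v ∘ σ then (1 : ℂ) else 0)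
  rw [hex.symProj_mul]
  simp only [Matrix.mul_apply, symProj_apply, h]

/-- Words of length `n` as pairs of their first `n - k` and their last `k` letters, split as in the
definition of `symTrace`. -/
def splitEquiv (d : ℕ) {k n : ℕ} (h : k ≤ n) :
    (Fin (n - k) → Fin d) × (Fin k → Fin d) ≃ (Fin n → Fin d) :=
  (Fin.appendEquiv (n - k) k).trans ((finCongr (Nat.sub_add_cancel h)).arrowCongr (Equiv.refl _))

theorem splitEquiv_apply {k : ℕ} (h : k ≤ n) (z : Fin (n - k) → Fin d) (x : Fin k → Fin d) :
    splitEquiv d h (z, x) = Fin.append z x ∘ Fin.cast (Nat.sub_add_cancel h).symm := rfl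

theorem symTrace_apply {k : ℕ} (h : k ≤ n) (A : Op d n) (x y : Fin k → Fin d) :
    symTrace k A x y = ∑ z, (symProj d n * A) (splitEquiv d h (z, x)) (splitEquiv d h (z, y)) := by
  rw [symTrace, dif_pos h]
  rfl

theorem IsExchangeable.symTrace_posSemidef {A : Op d n} (hex : IsExchangeable A)
    (hA : A.PosSemidef) {k : ℕ} (h : k ≤ n) : (symTrace k A).PosSemidef := by
  have h1 : symTrace k A = ∑ z, (symProj d n * A).submatrix
      (fun x => splitEquiv d h (z, x)) (fun x => splitEquiv d h (z, x)) := by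
    ext x y
    rw [symTrace_apply h, Matrix.sum_apply]
    rfl
  rw [h1]
  exact Matrix.posSemidef_sum _ fun z _ => (hex.symProj_mul_posSemidef hA).submatrix _

theorem trace_symTrace {k : ℕ} (h : k ≤ n) (A : Op d n) :
    (symTrace k A).trace = (symProj d n * A).trace := by
  simp only [Matrix.trace, Matrix.diag_apply, symTrace_apply h]
  rw [Finset.sum_comm, ← Equiv.sum_comp (splitEquiv d h), Fintype.sum_prod_type]

theorem IsExchangeable.isState_M {A : Op d n} (hex : IsExchangeable A) (hA : A.PosSemidef)
    (h0 : (symProj d n * A).trace ≠ 0) {k : ℕ} (h : k ≤ n) : IsState (M k A) := by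
  refine ⟨(hex.symTrace_posSemidef hA h).smul ?_, ?_⟩
  · exact inv_nonneg.2 (hex.symProj_mul_posSemidef hA).trace_nonneg
  · rw [M, Matrix.trace_smul, trace_symTrace h, smul_eq_mul, inv_mul_cancel₀ h0]

theorem IsExchangeable.isState_M₁ {A : Op d n} (hex : IsExchangeable A) (hA : A.PosSemidef)
    (h0 : (symProj d n * A).trace ≠ 0) (h : 1 ≤ n) : IsState (M₁ A) := by
  have h1 := hex.isState_M hA h0 h
  refine ⟨h1.1.submatrix fun a _ => a, ?_⟩
  rw [← h1.2, Matrix.trace, Matrix.trace, ← Equiv.sum_comp (Equiv.funUnique (Fin 1) (Fin d)).symm]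
  rfl

theorem symTrace_comp_left {k : ℕ} (A : Op d n) (σ : Equiv.Perm (Fin k)) (x y : Fin k → Fin d) :
    symTrace k A (x ∘ σ) y = symTrace k A x y := by
  by_cases h : k ≤ n
  · simp only [symTrace_apply h]
    refine Finset.sum_congr rfl fun z _ => ?_
    let τ : Equiv.Perm (Fin n) := (finCongr (Nat.sub_add_cancel h)).permCongr
      (finSumFinEquiv.permCongr (Equiv.sumCongr (Equiv.refl (Fin (n - k))) σ))
    have hτ : splitEquiv d h (z, x ∘ σ) = splitEquiv d h (z, x) ∘ τ := by
      funext i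
      obtain ⟨i, rfl⟩ := (finCongr (Nat.sub_add_cancel h)).surjective i
      obtain ⟨i, rfl⟩ := finSumFinEquiv.surjective i
      rcases i with i | i <;> simp [splitEquiv_apply, τ]
    rw [hτ, symProj_mul_comp_left]
  · simp [symTrace, h]

/-- For an exchangeable operator, the symmetric partial trace onto the last `k` qudits is the partial
trace onto any `k` distinct qudits, listed by `f`. `Function.extend f b v` is the word `v` with the
letters at the positions `f` replaced by `b`. -/
theorem IsExchangeable.sum_extend_eq_symTrace {A : Op d n} (hex : IsExchangeable A) {k : ℕ}
    {f : Fin k → Fin n} (hf : Function.Injective f) (a b : Fin k → Fin d) :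
    ∑ v : Fin n → Fin d, (if a = v ∘ f then 1 else 0) *
      (symProj d n * A) v (Function.extend f b v) = symTrace k A a b := by
  have h : k ≤ n := by simpa using Fintype.card_le_of_injective f hf
  -- `g` lists the last `k` positions; a permutation taking them to `f` reduces the claim to `f = g`.
  let g : Fin k → Fin n := fun i => Fin.cast (Nat.sub_add_cancel h) (Fin.natAdd (n - k) i)
  have hg : Function.Injective g := fun i j hij => by simpa [g] using hij
  obtain ⟨π, hπ⟩ := Equiv.Perm.exists_extending_pair g f hg hf
  have h1 : ∀ w : Fin n → Fin d,
      Function.extend f b (w ∘ π.symm) = Function.extend g b w ∘ π.symm := by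
    intro w
    funext i
    obtain ⟨i, rfl⟩ := π.surjective i
    rw [Function.comp_apply, Equiv.symm_apply_apply]
    by_cases hi : ∃ j, g j = i
    · obtain ⟨j, rfl⟩ := hi
      rw [hπ, hf.extend_apply, hg.extend_apply]
    · rw [Function.extend_apply' _ _ _ hi, Function.extend_apply', Function.comp_apply,
        Equiv.symm_apply_apply]
      rintro ⟨j, hj⟩
      exact hi ⟨j, π.injective ((hπ j).trans hj)⟩
  have h2 : ∀ w : Fin n → Fin d, (w ∘ π.symm) ∘ f = w ∘ g := by
    intro w
    funext j
    simp [← hπ j]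
  have h3 : ∀ z x, splitEquiv d h (z, x) ∘ g = x := by
    intro z x
    funext j
    simp [splitEquiv_apply, g]
  have h4 : ∀ z x, Function.extend g b (splitEquiv d h (z, x)) = splitEquiv d h (z, b) := by
    intro z x
    funext i
    obtain ⟨i, rfl⟩ := (finCongr (Nat.sub_add_cancel h)).surjective i
    refine Fin.addCases (fun i => ?_) (fun i => ?_) i
    · rw [Function.extend_apply']
      · simp [splitEquiv_apply]
      · rintro ⟨j, hj⟩
        have := congrArg Fin.val hj
        simp [g] at this
        omega
    · exact (hg.extend_apply b _ i).trans (by simp [splitEquiv_apply])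
  rw [← Equiv.sum_comp (π.arrowCongr (Equiv.refl (Fin d))), symTrace_apply h]
  change ∑ w : Fin n → Fin d, (if a = (w ∘ π.symm) ∘ f then 1 else 0) *
      (symProj d n * A) (w ∘ π.symm) (Function.extend f b (w ∘ π.symm)) = _
  simp only [h1, h2]
  have h5 : ∀ x y : Fin n → Fin d, (symProj d n * A) (x ∘ π.symm) (y ∘ π.symm) =
      (symProj d n * A) x y := fun x y =>
    (symProj_mul_comp_left A π.symm x _).trans (hex.symProj_mul_comp_right π.symm x y)
  simp only [h5]
  rw [← Equiv.sum_comp (splitEquiv d h), Fintype.sum_prod_type]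
  simp only [h3, h4, ite_mul, one_mul, zero_mul, Finset.sum_ite_eq, Finset.mem_univ, if_true]

/-! ### Counting permutations with one or two marked qudits -/

theorem one_two_apply (x y : Fin 2 → Fin d) :
    (1 : Op d 2) x y = (1 : QuditOp d) (x 0) (y 0) * (1 : QuditOp d) (x 1) (y 1) := by
  simp only [Matrix.one_apply, ← ite_and_eq_mul]
  refine if_congr ?_ rfl rfl
  rw [funext_iff, Fin.forall_fin_two]

/-- The linear functional `F ↦ ∑ A v u * F u v`, that is `Tr(A F)`, on functions of two words. -/
def pairing (A : Op d n) : ((Fin n → Fin d) → (Fin n → Fin d) → ℂ) →ₗ[ℂ] ℂ where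
  toFun F := ∑ u, ∑ v, A v u * F u v
  map_add' F G := by simp [mul_add, Finset.sum_add_distrib]
  map_smul' c F := by simp [Finset.mul_sum, mul_left_comm]

/-- The permutation count for `u` and the word `v` with the letters at the positions `f` replaced by
`y`, kept only if the replaced letters were `x`. -/
noncomputable def markedMatch {k : ℕ} (f : Fin k → Fin n) (x y : Fin k → Fin d)
    (u v : Fin n → Fin d) : ℂ :=
  (if x = v ∘ f then 1 else 0) * matchCount u (Function.extend f y v)

theorem IsExchangeable.sum_mul_matchCount {A : Op d n} (hex : IsExchangeable A)
    (v w : Fin n → Fin d) :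
    ∑ u, A v u * matchCount u w = n.factorial * (symProj d n * A) v w := by
  have hn : (n.factorial : ℂ) ≠ 0 := by exact_mod_cast n.factorial_ne_zero
  rw [hex.symProj_mul, Matrix.mul_apply, Finset.mul_sum]
  refine Finset.sum_congr rfl fun u _ => ?_
  rw [symProj_apply]
  field_simp

theorem IsExchangeable.pairing_matchCount {A : Op d n} (hex : IsExchangeable A) :
    pairing A matchCount = n.factorial * (symProj d n * A).trace := by
  simp only [pairing, LinearMap.coe_mk, AddHom.coe_mk]
  rw [Finset.sum_comm, Matrix.trace, Finset.mul_sum]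
  exact Finset.sum_congr rfl fun v _ => hex.sum_mul_matchCount v v

theorem IsExchangeable.pairing_markedMatch {A : Op d n} (hex : IsExchangeable A) {k : ℕ}
    {f : Fin k → Fin n} (hf : Function.Injective f) (x y : Fin k → Fin d) :
    pairing A (markedMatch f x y) = n.factorial * symTrace k A x y := by
  simp only [pairing, LinearMap.coe_mk, AddHom.coe_mk, markedMatch]
  rw [Finset.sum_comm, ← hex.sum_extend_eq_symTrace hf, Finset.mul_sum]
  refine Finset.sum_congr rfl fun v _ => ?_
  rw [mul_left_comm, ← hex.sum_mul_matchCount, Finset.mul_sum]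
  exact Finset.sum_congr rfl fun u _ => mul_left_comm _ _ _

theorem markedMatch_one (j : Fin n) (a b : Fin d) (u v : Fin n → Fin d) :
    markedMatch (fun _ : Fin 1 => j) (fun _ => a) (fun _ => b) u v =
      (if a = v j then 1 else 0) * matchCount u (Function.update v j b) := by
  have hj : Function.Injective fun _ : Fin 1 => j := Function.injective_of_subsingleton _
  have h : Function.extend (fun _ : Fin 1 => j) (fun _ => b) v = Function.update v j b := by
    funext i
    by_cases hi : i = j
    · subst hi
      rw [Function.update_self]
      exact hj.extend_apply _ _ 0
    · rw [Function.update_of_ne hi, Function.extend_apply']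
      rintro ⟨_, rfl⟩
      exact hi rfl
  rw [markedMatch, h]
  congr 1
  refine if_congr ⟨fun h => congrFun h 0, fun h => funext fun _ => h⟩ rfl rfl

theorem markedMatch_two {j l : Fin n} (hjl : l ≠ j) (x y : Fin 2 → Fin d) (u v : Fin n → Fin d) :
    markedMatch ![j, l] x y u v =
      (if x 0 = v j then 1 else 0) * ((if x 1 = v l then 1 else 0) *
        matchCount u (Function.update (Function.update v j (y 0)) l (y 1))) := by
  have hj : Function.Injective ![j, l] := by
    intro a b
    fin_cases a <;> fin_cases b <;> simp [hjl, hjl.symm]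
  have h : Function.extend ![j, l] y v =
      Function.update (Function.update v j (y 0)) l (y 1) := by
    funext i
    by_cases hi : i = l
    · subst hi
      rw [Function.update_self]
      exact hj.extend_apply y v 1
    · rw [Function.update_of_ne hi]
      by_cases hi' : i = j
      · subst hi'
        rw [Function.update_self]
        exact hj.extend_apply y v 0
      · rw [Function.update_of_ne hi', Function.extend_apply']
        rintro ⟨a, rfl⟩
        fin_cases a
        · exact hi' rfl
        · exact hi rfl
  rw [markedMatch, h, ← mul_assoc, ← ite_and_eq_mul]
  congr 1
  refine if_congr ?_ rfl rfl
  rw [funext_iff, Fin.forall_fin_two]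
  rfl

theorem matchCount_cons_eq (a b : Fin d) :
    (fun u v : Fin n → Fin d => matchCount (Fin.cons a u : Fin (n + 1) → Fin d)
      (Fin.cons b v : Fin (n + 1) → Fin d)) =
      (if a = b then (1 : ℂ) else 0) • matchCount +
        ∑ j : Fin n, markedMatch (fun _ : Fin 1 => j) (fun _ => a) (fun _ => b) := by
  funext u v
  simp only [matchCount_cons, Pi.add_apply, Pi.smul_apply, Finset.sum_apply, markedMatch_one,
    smul_eq_mul]

/-- Expansion of the permanent along the two rows added in front, sorted by whether an added index is
matched with the other column of the added pair, or with a position of `v`. -/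
theorem matchCount_cons_cons_eq (x y : Fin 2 → Fin d) :
    (fun u v : Fin n → Fin d =>
      matchCount (Fin.cons (x 0) (Fin.cons (x 1) u : Fin (n + 1) → Fin d) : Fin (n + 2) → Fin d)
        (Fin.cons (y 0) (Fin.cons (y 1) v : Fin (n + 1) → Fin d) : Fin (n + 2) → Fin d)) =
      (if x 0 = y 0 then (1 : ℂ) else 0) • ((if x 1 = y 1 then (1 : ℂ) else 0) • matchCount +
        ∑ j : Fin n, markedMatch (fun _ : Fin 1 => j) (fun _ => x 1) (fun _ => y 1)) +
      (if x 0 = y 1 then (1 : ℂ) else 0) • ((if x 1 = y 0 then (1 : ℂ) else 0) • matchCount +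
        ∑ j : Fin n, markedMatch (fun _ : Fin 1 => j) (fun _ => x 1) (fun _ => y 0)) +
      ∑ j : Fin n,
        ((if x 1 = y 1 then (1 : ℂ) else 0) •
            markedMatch (fun _ : Fin 1 => j) (fun _ => x 0) (fun _ => y 0) +
          (if x 1 = y 0 then (1 : ℂ) else 0) •
            markedMatch (fun _ : Fin 1 => j) (fun _ => x 0) (fun _ => y 1) +
          ∑ l ∈ Finset.univ.erase j, markedMatch ![j, l] x y) := by
  funext u v
  rw [matchCount_cons, Fin.sum_univ_succ, ← add_assoc]
  simp only [Fin.cons_zero, Fin.cons_succ, Fin.update_cons_zero, ← Fin.cons_update,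
    matchCount_cons, Pi.add_apply, Pi.smul_apply, Finset.sum_apply, markedMatch_one,
    smul_eq_mul]
  congr 1
  refine Finset.sum_congr rfl fun j _ => ?_
  rw [← Finset.add_sum_erase _ _ (Finset.mem_univ j), Function.update_self,
    Function.update_idem, mul_add, mul_add, add_assoc]
  congr 1
  · ring
  congr 1
  · ring
  rw [Finset.mul_sum]
  refine Finset.sum_congr rfl fun l hl => ?_
  have hl' := Finset.ne_of_mem_erase hl
  rw [markedMatch_two hl', Function.update_of_ne hl']

theorem symTrace_eq_smul_M {A : Op d n} (h0 : (symProj d n * A).trace ≠ 0) (k : ℕ) :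
    symTrace k A = (symProj d n * A).trace • M k A := by
  rw [M, smul_smul, mul_inv_cancel₀ h0, one_smul]

/-- The first moment, before normalization. -/
theorem IsExchangeable.pairing_cons {A : Op d n} (hex : IsExchangeable A)
    (h0 : (symProj d n * A).trace ≠ 0) (a b : Fin d) :
    pairing A (fun u v => matchCount (Fin.cons a u : Fin (n + 1) → Fin d)
      (Fin.cons b v : Fin (n + 1) → Fin d)) =
      n.factorial * (symProj d n * A).trace * (1 + (n : ℂ) • M₁ A) a b := by
  rw [matchCount_cons_eq, map_add, map_smul, map_sum]
  simp only [hex.pairing_markedMatch (Function.injective_of_subsingleton _),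
    hex.pairing_matchCount, symTrace_eq_smul_M h0, Finset.sum_const, Finset.card_univ,
    Fintype.card_fin, nsmul_eq_mul, smul_eq_mul, Matrix.add_apply, Matrix.smul_apply,
    Matrix.one_apply, M₁, Matrix.of_apply]
  ring

theorem symProj_two : symProj d 2 = (2 : ℂ)⁻¹ • (1 + permOp d (Equiv.swap (0 : Fin 2) 1)) := by
  have h : (Finset.univ : Finset (Equiv.Perm (Fin 2))) = {1, Equiv.swap 0 1} := by decide
  rw [symProj, h, Finset.sum_pair (by decide), permOp_one]
  simp

theorem tensor_two_apply (B : Fin 2 → QuditOp d) (x y : Fin 2 → Fin d) :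
    tensor B x y = B 0 (x 0) (y 0) * B 1 (x 1) (y 1) := by
  simp [tensor, Fin.prod_univ_two]

theorem tensorPow_one_add_smul (c : ℂ) (B : QuditOp d) :
    tensorPow 2 (1 + c • B) =
      1 + c • tensor ![B, 1] + c • tensor ![1, B] + c ^ 2 • tensorPow 2 B := by
  ext x y
  simp only [tensorPow, tensor_two_apply, Matrix.add_apply, Matrix.smul_apply, smul_eq_mul,
    one_two_apply,
    Matrix.cons_val_zero, Matrix.cons_val_one]
  ring

theorem permOp_swap_mul_M₂ (A : Op d n) :
    permOp d (Equiv.swap (0 : Fin 2) 1) * M₂ A = M₂ A := by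
  ext x y
  simp only [permOp_mul_apply, M₂, M, Matrix.smul_apply, symTrace_comp_left]

/-- The second moment, before normalization. -/
theorem IsExchangeable.pairing_cons_cons {A : Op d n} (hex : IsExchangeable A)
    (h0 : (symProj d n * A).trace ≠ 0) (x y : Fin 2 → Fin d) :
    pairing A (fun u v =>
      matchCount (Fin.cons (x 0) (Fin.cons (x 1) u : Fin (n + 1) → Fin d) : Fin (n + 2) → Fin d)
        (Fin.cons (y 0) (Fin.cons (y 1) v : Fin (n + 1) → Fin d) : Fin (n + 2) → Fin d)) =
      n.factorial * (symProj d n * A).trace *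
        ((1 + permOp d (Equiv.swap (0 : Fin 2) 1)) *
            (1 + (n : ℂ) • tensor ![M₁ A, 1] + (n : ℂ) • tensor ![1, M₁ A]) +
          ((n : ℂ) * ((n : ℂ) - 1)) • M₂ A) x y := by
  have hsum : ∑ j : Fin n, ∑ l ∈ Finset.univ.erase j, pairing A (markedMatch ![j, l] x y) =
      ((n : ℂ) * ((n : ℂ) - 1)) * (n.factorial * symTrace 2 A x y) := by
    have h : ∀ j : Fin n, ∀ l ∈ Finset.univ.erase j, pairing A (markedMatch ![j, l] x y) =
        n.factorial * symTrace 2 A x y := by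
      intro j l hl
      have hl' := Finset.ne_of_mem_erase hl
      refine hex.pairing_markedMatch ?_ x y
      intro a b
      fin_cases a <;> fin_cases b <;> simp [hl', hl'.symm]
    rw [Finset.sum_congr rfl fun j _ => Finset.sum_congr rfl (h j)]
    simp only [Finset.sum_const, Finset.card_erase_of_mem (Finset.mem_univ _), Finset.card_univ,
      Fintype.card_fin, nsmul_eq_mul]
    -- `n - 1` is truncated at `n = 0`, where the prefactor `n` vanishes.
    cases n with
    | zero => simp
    | succ m => push_cast [Nat.add_sub_cancel]; ring
  rw [matchCount_cons_cons_eq]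
  simp only [map_add, map_smul, map_sum, Finset.sum_add_distrib, hsum]
  simp only [hex.pairing_markedMatch (Function.injective_of_subsingleton _),
    hex.pairing_matchCount, symTrace_eq_smul_M h0, Finset.sum_const, Finset.card_univ,
    Fintype.card_fin, nsmul_eq_mul, smul_eq_mul, add_mul, one_mul, Matrix.add_apply,
    Matrix.smul_apply, permOp_mul_apply, tensor_two_apply, one_two_apply, M₂,
    Matrix.cons_val_zero, Matrix.cons_val_one, Function.comp_apply, Equiv.swap_apply_left,
    Equiv.swap_apply_right]
  simp only [Matrix.one_apply, M₁, Matrix.of_apply, Function.comp_apply,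
    Equiv.swap_apply_left, Equiv.swap_apply_right]
  ring

/-! ### The law of the outcome and the conditional moments -/

instance (d : ℕ) : IsFiniteMeasure (haar d) := by
  by_cases h : (volume : Measure (EuclideanSpace ℂ (Fin d))).toSphere Set.univ = 0
  · rw [haar, Measure.measure_univ_eq_zero.1 h, smul_zero]
    infer_instance
  · exact ⟨by
      rw [haar, Measure.smul_apply, smul_eq_mul, ENNReal.inv_mul_cancel h (measure_ne_top _ _)]
      exact ENNReal.one_lt_top⟩

theorem norm_proj_apply_le (ψ : UnitVec d) (a b : Fin d) : ‖proj ψ a b‖ ≤ 1 := by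
  have h : ∀ c, ‖ψ.1 c‖ ≤ 1 := fun c =>
    (PiLp.norm_apply_le ψ.1 c).trans_eq (mem_sphere_zero_iff_norm.1 ψ.2)
  rw [proj, Matrix.of_apply, norm_mul, norm_star]
  exact mul_le_one₀ (h a) (norm_nonneg _) (h b)

theorem continuous_proj (a b : Fin d) : Continuous fun ψ : UnitVec d => proj ψ a b := by
  unfold proj
  simp only [Matrix.of_apply]
  fun_prop

theorem continuous_tensorPow_proj (u v : Fin n → Fin d) :
    Continuous fun ψ : UnitVec d => tensorPow n (proj ψ) u v :=
  by
  simp only [tensorPow, tensor, Matrix.of_apply]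
  exact continuous_finsetProd _ fun i _ => continuous_proj (u i) (v i)

theorem trace_effect_mul (A : Op d n) (ψ : UnitVec d) :
    (effect n ψ * A).trace =
      symDim d n * ∑ u, ∑ v, A v u * tensorPow n (proj ψ) u v := by
  rw [effect, Matrix.smul_mul, Matrix.trace_smul, smul_eq_mul, Matrix.trace]
  simp only [Matrix.diag_apply, Matrix.mul_apply, mul_comm]

theorem continuous_trace_effect_mul (A : Op d n) :
    Continuous fun ψ : UnitVec d => (effect n ψ * A).trace := by
  simp only [trace_effect_mul]
  refine continuous_const.mul (continuous_finsetSum _ fun u _ => continuous_finsetSum _ fun v _ =>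
    continuous_const.mul (continuous_tensorPow_proj u v))

theorem trace_effect_mul_nonneg {A : Op d n} (hA : A.PosSemidef) (ψ : UnitVec d) :
    0 ≤ (effect n ψ * A).trace := by
  -- `w` is the vector `ψ^{⊗ n}`, so that the trace is `⟨w, A w⟩`.
  let w : (Fin n → Fin d) → ℂ := fun u => ∏ i, ψ.1 (u i)
  have h : tensorPow n (proj ψ) = Matrix.vecMulVec w (star w) := by
    ext u v
    simp only [tensorPow, tensor, proj, Matrix.of_apply, Matrix.vecMulVec_apply, Pi.star_apply, w,
      star_prod, Finset.prod_mul_distrib]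
  rw [effect, Matrix.smul_mul, Matrix.trace_smul, smul_eq_mul, h, Matrix.vecMulVec_mul,
    Matrix.trace_vecMulVec, dotProduct_comm, ← Matrix.dotProduct_mulVec]
  exact mul_nonneg (Nat.cast_nonneg _) (hA.dotProduct_mulVec_nonneg w)

/-- Integrals against the outcome density, for an integrand `g` that extends the word pair `u`, `v` of
the density to the longer word pair `p u`, `q v`. -/
theorem integral_mul_trace_effect (hd : 1 ≤ d) (A : Op d n) {m : ℕ} (g : UnitVec d → ℂ)
    (p q : (Fin n → Fin d) → (Fin m → Fin d))
    (hg : ∀ ψ u v, g ψ * tensorPow n (proj ψ) u v = tensorPow m (proj ψ) (p u) (q v)) :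
    ∫ ψ, g ψ * (effect n ψ * A).trace ∂haar d =
      symDim d n * ((d - 1).factorial / (m + d - 1).factorial : ℂ) *
        pairing A (fun u v => matchCount (p u) (q v)) := by
  have h : ∀ ψ, g ψ * (effect n ψ * A).trace =
      symDim d n * ∑ u, ∑ v, A v u * tensorPow m (proj ψ) (p u) (q v) := by
    intro ψ
    rw [trace_effect_mul, mul_left_comm, Finset.mul_sum]
    congr 1
    refine Finset.sum_congr rfl fun u _ => ?_
    rw [Finset.mul_sum]
    exact Finset.sum_congr rfl fun v _ => by rw [← hg]; ring
  have hint : ∀ u v, Integrable (fun ψ => A v u * tensorPow m (proj ψ) (p u) (q v)) (haar d) :=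
    fun u v => (continuous_const.mul (continuous_tensorPow_proj _ _)).integrable_of_hasCompactSupport
      (HasCompactSupport.of_compactSpace _)
  simp only [h]
  rw [integral_const_mul, integral_finsetSum _ fun u _ => integrable_finsetSum _ fun v _ =>
    hint u v, mul_assoc]
  congr 1
  simp only [pairing, LinearMap.coe_mk, AddHom.coe_mk, Finset.mul_sum]
  refine Finset.sum_congr rfl fun u _ => ?_
  rw [integral_finsetSum _ fun v _ => hint u v]
  refine Finset.sum_congr rfl fun v _ => ?_
  rw [integral_const_mul, integral_proj_tensorPow hd, mul_left_comm]

theorem symDim_mul_factorial (hd : 1 ≤ d) (n : ℕ) :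
    (symDim d n : ℂ) * (d - 1).factorial * n.factorial = (n + d - 1).factorial := by
  have h := Nat.choose_mul_factorial_mul_factorial (n := n + d - 1) (k := d - 1) (by omega)
  have h2 : n + d - 1 - (d - 1) = n := by omega
  rw [h2] at h
  exact_mod_cast h

theorem factorial_succ_add_pred (hd : 1 ≤ d) (n : ℕ) :
    ((n + 1 + d - 1).factorial : ℂ) = (d + n) * (n + d - 1).factorial := by
  have h : n + 1 + d - 1 = n + d - 1 + 1 := by omega
  have h2 : n + d - 1 + 1 = d + n := by omega
  rw [h, Nat.factorial_succ, h2]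
  push_cast
  rfl

theorem tensorPow_cons (B : QuditOp d) (a b : Fin d) (u v : Fin n → Fin d) :
    tensorPow (n + 1) B (Fin.cons a u : Fin (n + 1) → Fin d) (Fin.cons b v : Fin (n + 1) → Fin d) =
      B a b * tensorPow n B u v := by
  simp [tensorPow, tensor, Fin.prod_univ_succ]

theorem IsExchangeable.integral_trace_effect {A : Op d n} (hex : IsExchangeable A) (hd : 1 ≤ d) :
    ∫ ψ, (effect n ψ * A).trace ∂haar d = (symProj d n * A).trace := by
  have h := integral_mul_trace_effect hd A (fun _ => 1) id id (fun ψ u v => one_mul _)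
  simp only [one_mul, id] at h
  rw [h]
  change _ * pairing A matchCount = _
  rw [hex.pairing_matchCount]
  have h1 := symDim_mul_factorial hd n
  have h2 : ((n + d - 1).factorial : ℂ) ≠ 0 := by exact_mod_cast Nat.factorial_ne_zero _
  field_simp
  linear_combination (symProj d n * A).trace * h1

theorem IsExchangeable.integral_proj_mul_trace_effect {A : Op d n} (hex : IsExchangeable A)
    (hd : 1 ≤ d) (h0 : (symProj d n * A).trace ≠ 0) (a b : Fin d) :
    ∫ ψ, proj ψ a b * (effect n ψ * A).trace ∂haar d =
      (symProj d n * A).trace * (((d : ℂ) + n)⁻¹ • (1 + (n : ℂ) • M₁ A)) a b := by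
  rw [integral_mul_trace_effect hd A (fun ψ => proj ψ a b)
    (fun u => (Fin.cons a u : Fin (n + 1) → Fin d)) (fun v => (Fin.cons b v : Fin (n + 1) → Fin d))
    (fun ψ u v => (tensorPow_cons _ _ _ _ _).symm), hex.pairing_cons h0,
    factorial_succ_add_pred hd, ← symDim_mul_factorial hd, Matrix.smul_apply, smul_eq_mul]
  have h2 : ((n + d - 1).factorial : ℂ) ≠ 0 := by exact_mod_cast Nat.factorial_ne_zero _
  rw [← symDim_mul_factorial hd] at h2
  have h3 : (d : ℂ) + n ≠ 0 := by
    have : d + n ≠ 0 := by omega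
    exact_mod_cast this
  have h4 := left_ne_zero_of_mul h2
  have h5 := right_ne_zero_of_mul h2
  have h6 := left_ne_zero_of_mul h4
  have h7 := right_ne_zero_of_mul h4
  field_simp

theorem IsExchangeable.integral_tensorPow_two_mul_trace_effect {A : Op d n}
    (hex : IsExchangeable A) (hd : 1 ≤ d) (h0 : (symProj d n * A).trace ≠ 0)
    (x y : Fin 2 → Fin d) :
    ∫ ψ, tensorPow 2 (proj ψ) x y * (effect n ψ * A).trace ∂haar d =
      (symProj d n * A).trace * ((((d : ℂ) + n) * ((d : ℂ) + n + 1))⁻¹ •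
        ((1 + permOp d (Equiv.swap (0 : Fin 2) 1)) *
            (1 + (n : ℂ) • tensor ![M₁ A, 1] + (n : ℂ) • tensor ![1, M₁ A]) +
          ((n : ℂ) * ((n : ℂ) - 1)) • M₂ A)) x y := by
  rw [integral_mul_trace_effect hd A (fun ψ => tensorPow 2 (proj ψ) x y)
    (fun u => (Fin.cons (x 0) (Fin.cons (x 1) u : Fin (n + 1) → Fin d) : Fin (n + 2) → Fin d))
    (fun v => (Fin.cons (y 0) (Fin.cons (y 1) v : Fin (n + 1) → Fin d) : Fin (n + 2) → Fin d))
    (fun ψ u v => by rw [tensorPow_cons, tensorPow_cons, tensorPow, tensor_two_apply, mul_assoc]),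
    hex.pairing_cons_cons h0,
    factorial_succ_add_pred hd, factorial_succ_add_pred hd, ← symDim_mul_factorial hd,
    Matrix.smul_apply _ _ x y, smul_eq_mul]
  have h2 : ((n + d - 1).factorial : ℂ) ≠ 0 := by exact_mod_cast Nat.factorial_ne_zero _
  rw [← symDim_mul_factorial hd] at h2
  have h3 : (d : ℂ) + n ≠ 0 := by
    have : d + n ≠ 0 := by omega
    exact_mod_cast this
  have h3' : (d : ℂ) + (n + 1) ≠ 0 := by exact_mod_cast (d + n).succ_ne_zero
  have h4 := left_ne_zero_of_mul h2
  have h5 := right_ne_zero_of_mul h2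
  have h6 := left_ne_zero_of_mul h4
  have h7 := right_ne_zero_of_mul h4
  push_cast
  rw [add_assoc (d : ℂ) n 1]
  field_simp

theorem outcomeLaw_restrict_success (A : Op d n) :
    (outcomeLaw A).restrict (success d) =
      ((haar d).withDensity fun ψ => ENNReal.ofReal ((effect n ψ * A).trace.re)).map Sum.inl := by
  have hs : MeasurableSet (success d) := measurableSet_range_inl
  have hbot : (Measure.dirac (Sum.inr () : Outcome d)).restrict (success d) = 0 := by
    rw [Measure.restrict_eq_zero, Measure.dirac_apply' _ hs]
    simp [success]
  rw [outcomeLaw, Measure.restrict_add, Measure.restrict_smul, hbot, smul_zero, add_zero,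
    Measure.restrict_map measurable_inl hs]
  congr 1
  rw [success, Set.preimage_range, Measure.restrict_univ]

/-- Integrals over the event of success, by the Born rule. -/
theorem setIntegral_success {A : Op d n} (hA : A.PosSemidef) {Ω : Type*} [MeasurableSpace Ω]
    {P : Measure Ω} {X : Ω → Outcome d} (hX : Measurable X) (hlaw : P.map X = outcomeLaw A)
    {f : Outcome d → ℂ} (hf : Measurable f) :
    ∫ ω in X ⁻¹' success d, f (X ω) ∂P =
      ∫ ψ, f (Sum.inl ψ) * (effect n ψ * A).trace ∂haar d := by
  have hs : MeasurableSet (success d) := measurableSet_range_inl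
  have hm : Measurable fun ψ : UnitVec d => ENNReal.ofReal ((effect n ψ * A).trace.re) :=
    (Complex.measurable_re.comp (continuous_trace_effect_mul A).measurable).ennreal_ofReal
  rw [← setIntegral_map hs hf.aestronglyMeasurable hX.aemeasurable, hlaw,
    outcomeLaw_restrict_success, integral_map measurable_inl.aemeasurable hf.aestronglyMeasurable,
    integral_withDensity_eq_integral_toReal_smul hm
      (Filter.Eventually.of_forall fun _ => ENNReal.ofReal_lt_top)]
  refine integral_congr_ae (Filter.Eventually.of_forall fun ψ => ?_)
  have h := trace_effect_mul_nonneg hA ψ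
  have h1 : (((effect n ψ * A).trace.re : ℝ) : ℂ) = (effect n ψ * A).trace :=
    (Complex.eq_re_of_ofReal_le h).symm
  simp only
  rw [ENNReal.toReal_ofReal (Complex.le_def.1 h).1, Complex.real_smul, h1, mul_comm]

/-- The probability of success is `Tr(Π A)`. -/
theorem IsExchangeable.measureReal_success {A : Op d n} (hex : IsExchangeable A)
    (hA : A.PosSemidef) (hd : 1 ≤ d) {Ω : Type*} [MeasurableSpace Ω]
    {P : Measure Ω} {X : Ω → Outcome d} (hX : Measurable X) (hlaw : P.map X = outcomeLaw A) :
    (P.real (X ⁻¹' success d) : ℂ) = (symProj d n * A).trace := by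
  have h := setIntegral_success hA hX hlaw (f := fun _ => 1) measurable_const
  simp only [one_mul, hex.integral_trace_effect hd] at h
  simpa using h

theorem IsExchangeable.integral_condSuccess {A : Op d n} (hex : IsExchangeable A)
    (hA : A.PosSemidef) (hd : 1 ≤ d) {Ω : Type*} [MeasurableSpace Ω]
    {P : Measure Ω} {X : Ω → Outcome d} (hX : Measurable X) (hlaw : P.map X = outcomeLaw A)
    {f : Outcome d → ℂ} (hf : Measurable f) :
    ∫ ω, f (X ω) ∂condSuccess P X =
      (symProj d n * A).trace⁻¹ *
        ∫ ψ, f (Sum.inl ψ) * (effect n ψ * A).trace ∂haar d := by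
  rw [condSuccess, ProbabilityTheory.cond, integral_smul_measure, ENNReal.toReal_inv,
    setIntegral_success hA hX hlaw hf, Complex.real_smul, Complex.ofReal_inv,
    ← hex.measureReal_success hA hd hX hlaw]
  rfl

theorem measurable_tensorPow_Psi (k : ℕ) (x y : Fin k → Fin d) :
    Measurable fun o : Outcome d => tensorPow k (Psi o) x y :=
  measurable_fun_sum (continuous_tensorPow_proj x y).measurable measurable_from_top

theorem measurable_Psi (a b : Fin d) : Measurable fun o : Outcome d => Psi o a b :=
  measurable_fun_sum (continuous_proj a b).measurable measurable_const

theorem norm_Psi_apply_le (o : Outcome d) (a b : Fin d) : ‖Psi o a b‖ ≤ 1 := by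
  rcases o with ψ | _
  · exact norm_proj_apply_le ψ a b
  · simp [Psi]

theorem matIntegrable_Psi {Ω : Type*} [MeasurableSpace Ω] (μ : Measure Ω) [IsFiniteMeasure μ]
    {X : Ω → Outcome d} (hX : Measurable X) : MatIntegrable (fun ω => Psi (X ω)) μ := fun a b =>
  Integrable.of_bound ((measurable_Psi a b).comp hX).aestronglyMeasurable 1
    (Filter.Eventually.of_forall fun ω => norm_Psi_apply_le (X ω) a b)

theorem matIntegrable_tensorPow_Psi {Ω : Type*} [MeasurableSpace Ω] (μ : Measure Ω)
    [IsFiniteMeasure μ] {X : Ω → Outcome d} (hX : Measurable X) (k : ℕ) :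
    MatIntegrable (fun ω => tensorPow k (Psi (X ω))) μ := fun x y =>
  Integrable.of_bound ((measurable_tensorPow_Psi k x y).comp hX).aestronglyMeasurable 1
    (Filter.Eventually.of_forall fun ω => by
      simp only [tensorPow, tensor, Matrix.of_apply, norm_prod]
      exact Finset.prod_le_one (fun _ _ => norm_nonneg _)
        fun i _ => norm_Psi_apply_le (X ω) (x i) (y i))

end SymmetricMeasurement

theorem theorem3 (d n : ℕ) (hd : 1 ≤ d) (A : Op d n) (hA : IsState A) (hex : IsExchangeable A)
    {Ω : Type*} [MeasurableSpace Ω] (P : MeasureTheory.Measure Ω)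
    [MeasureTheory.IsProbabilityMeasure P]
    (X : Ω → Outcome d) (hX : Measurable X)
    (hlaw : P.map X = outcomeLaw A)
    (hsucc : P (X ⁻¹' success d) ≠ 0)
    (Ψ : Ω → QuditOp d) (hΨ : ∀ ω, Ψ ω = Psi (X ω)) :
    (1 ≤ n → IsState (M₁ A)) ∧ (2 ≤ n → IsState (M₂ A)) ∧
    MatIntegrable Ψ (condSuccess P X) ∧ MatIntegrable (fun ω => tensorPow 2 (Ψ ω)) (condSuccess P X) ∧
    expect (condSuccess P X) Ψ = ((d : ℂ) + n)⁻¹ • (1 + (n : ℂ) • M₁ A) ∧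
    expect (condSuccess P X) (fun ω => tensorPow 2 (Ψ ω)) =
      (2 / (((d : ℂ) + n) * ((d : ℂ) + n + 1))) •
        (symProj d 2 *
          (tensorPow 2 (1 + (n : ℂ) • M₁ A) + (n.choose 2 : ℂ) • M₂ A
            - (n : ℂ) ^ 2 • tensorPow 2 (M₁ A))) ∧
    matVariance (condSuccess P X) Ψ =
      (((d : ℂ) + n) * ((d : ℂ) + n + 1))⁻¹ •
          (permOp d (Equiv.swap (0 : Fin 2) 1) *
            (1 + (n : ℂ) • tensor ![M₁ A, 1] + (n : ℂ) • tensor ![1, M₁ A]))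
        + (((d : ℂ) + n) * ((d : ℂ) + n + 1))⁻¹ •
          (((n : ℂ) * ((n : ℂ) - 1)) • M₂ A - (n : ℂ) ^ 2 • tensorPow 2 (M₁ A))
        - (((d : ℂ) + n) ^ 2 * ((d : ℂ) + n + 1))⁻¹ • tensorPow 2 (1 + (n : ℂ) • M₁ A) := by
  obtain rfl : Ψ = fun ω => Psi (X ω) := funext hΨ
  have hpos := hA.1
  have h0 : (symProj d n * A).trace ≠ 0 := by
    rw [← hex.measureReal_success hpos hd hX hlaw]
    exact_mod_cast (ENNReal.toReal_pos hsucc (measure_ne_top _ _)).ne'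
  have : IsProbabilityMeasure (condSuccess P X) := ProbabilityTheory.cond_isProbabilityMeasure hsucc
  have hD : (d : ℂ) + n ≠ 0 := by
    have : d + n ≠ 0 := by omega
    exact_mod_cast this
  have hD1 : (d : ℂ) + n + 1 ≠ 0 := by exact_mod_cast (d + n).succ_ne_zero
  have hE1 : expect (condSuccess P X) (fun ω => Psi (X ω)) =
      ((d : ℂ) + n)⁻¹ • (1 + (n : ℂ) • M₁ A) := by
    ext a b
    rw [expect, Matrix.of_apply, hex.integral_condSuccess hpos hd hX hlaw (measurable_Psi a b)]
    simp only [Psi]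
    rw [hex.integral_proj_mul_trace_effect hd h0, inv_mul_cancel_left₀ h0]
  have hE2 : expect (condSuccess P X) (fun ω => tensorPow 2 (Psi (X ω))) =
      (((d : ℂ) + n) * ((d : ℂ) + n + 1))⁻¹ •
        ((1 + permOp d (Equiv.swap (0 : Fin 2) 1)) *
            (1 + (n : ℂ) • tensor ![M₁ A, 1] + (n : ℂ) • tensor ![1, M₁ A]) +
          ((n : ℂ) * ((n : ℂ) - 1)) • M₂ A) := by
    ext x y
    rw [expect, Matrix.of_apply,
      hex.integral_condSuccess hpos hd hX hlaw (measurable_tensorPow_Psi 2 x y)]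
    simp only [Psi]
    rw [hex.integral_tensorPow_two_mul_trace_effect hd h0, inv_mul_cancel_left₀ h0]
  refine ⟨hex.isState_M₁ hpos h0, hex.isState_M hpos h0, matIntegrable_Psi _ hX,
    matIntegrable_tensorPow_Psi _ hX 2, hE1, ?_, ?_⟩
  · rw [hE2, tensorPow_one_add_smul, symProj_two]
    have hc : (n.choose 2 : ℂ) = (n : ℂ) * ((n : ℂ) - 1) / 2 := Nat.cast_choose_two ℂ n
    have hM : (1 + permOp d (Equiv.swap (0 : Fin 2) 1)) * M₂ A = (2 : ℂ) • M₂ A := by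
      rw [Matrix.add_mul, Matrix.one_mul, permOp_swap_mul_M₂, two_smul]
    rw [add_sub_right_comm, add_sub_cancel_right, Matrix.smul_mul, Matrix.mul_add _ _ (_ • M₂ A),
      Matrix.mul_smul _ _ (M₂ A), hM, hc]
    generalize (1 + permOp d (Equiv.swap (0 : Fin 2) 1)) *
      (1 + (n : ℂ) • tensor ![M₁ A, 1] + (n : ℂ) • tensor ![1, M₁ A]) = B
    ext x y
    simp only [Matrix.add_apply, Matrix.smul_apply, smul_eq_mul]
    field_simp
  · rw [matVariance, hE1, hE2]
    have hsq : tensorPow 2 (((d : ℂ) + n)⁻¹ • (1 + (n : ℂ) • M₁ A)) =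
        (((d : ℂ) + n) ^ 2)⁻¹ • tensorPow 2 (1 + (n : ℂ) • M₁ A) := by
      ext x y
      simp only [tensorPow, tensor_two_apply, Matrix.smul_apply, smul_eq_mul]
      field_simp
    rw [hsq, tensorPow_one_add_smul, Matrix.add_mul, Matrix.one_mul]
    generalize 1 + (n : ℂ) • tensor ![M₁ A, 1] + (n : ℂ) • tensor ![1, M₁ A] = B
    generalize permOp d (Equiv.swap (0 : Fin 2) 1) * B = C
    ext x y
    simp only [Matrix.add_apply, Matrix.sub_apply, Matrix.smul_apply, smul_eq_mul]
    field_simp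
    ring
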